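/- Let $\Bbbk$ be an algebraically closed field of characteristic $0$ and let $H$ be a finite-dimensional Hopf algebra over $\Bbbk$ that is not cosemisimple. Let $H_0\subseteq H_1\subseteq\cdots$ be the coradical filtration of $H$, and let $G(H)$ be the group of group-like elements. Fix a coideal $I$ of $H$ with $H=H_0\oplus I$, let $\pi:H\to H_0$ be the projection with kernel $I$, and regard $H$ as an $H_0$-bicomodule via $\rho_L=(\pi\otimes\mathrm{id})\Delta$ and $\rho_R=(\mathrm{id}\otimes\pi)\Delta$. Put $P_n=H_n\cap I$ and for each $n\ge 1$ fix an $H_0$-subbicomodule $Q_n$ with $P_n=P_{n-1}\oplus Q_n$. A simple subcoalgebra $D$ has $\dim D=d_D^2$ for an integer $d_D\ge1$; let $V_D$ and $V_D^*$ be the simple right and left $D$-comodules, which are unique up to isomorphism. For simple subcoalgebras $D,E$ let $Q_n^{D,E}$ be the sum of the simple subbicomodules of $Q_n$ isomorphic to $V_D^*\otimes V_E$. For $d_1,d_2\ge 1$ define the blocks $$B_0^{d_1,d_2}=\begin{cases}\bigoplus_{d_D=d_1}D,& d_1=d_2,\\ 0,& d_1\neq d_2,\end{cases}\qquad B_n^{d_1,d_2}=\bigoplus_{d_D=d_1,\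 d_E=d_2}Q_n^{D,E}\quad(n\ge 1).$$ Then $\dim B_0^{1,1}=|G(H)|$, and this number divides $\dim B_n^{d_1,d_2}$ for all $n\ge 0$ and $d_1,d_2\ge 1$. -/

import Mathlib

open scoped TensorProduct

noncomputable section

namespace HopfBlocks

section Coalgebra

variable (k : Type*) [Field k] {C : Type*} [AddCommGroup C] [Module k C]

/-- For subspaces `A, B` of `C`, the subspace `A ⊗ B` of `C ⊗ C`. -/
def tensorSub (A B : Submodule k C) : Submodule k (C ⊗[k] C) :=
  LinearMap.range (TensorProduct.map A.subtype B.subtype)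

variable [Coalgebra k C]

/-- `D` is a subcoalgebra of `C`: `Δ(D) ⊆ D ⊗ D`. -/
def IsSubcoalgebra (D : Submodule k C) : Prop :=
  D.map (Coalgebra.comul (R := k) (A := C)) ≤ tensorSub k D D

/-- `D` is a simple subcoalgebra: nonzero, with no subcoalgebras besides `0` and itself. -/
def IsSimpleSubcoalgebra (D : Submodule k C) : Prop :=
  IsSubcoalgebra k D ∧ D ≠ ⊥ ∧ ∀ E : Submodule k C, IsSubcoalgebra k E → E ≤ D → E = ⊥ ∨ E = D

variable (C) in
/-- The coradical `C₀`: the sum of all simple subcoalgebras. -/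
def coradical : Submodule k C :=
  sSup {D : Submodule k C | IsSimpleSubcoalgebra k D}

variable (C) in
/-- `C` is cosemisimple if it equals its coradical. -/
def IsCosemisimple : Prop := coradical k C = ⊤

variable (C) in
/-- The coradical filtration: `C₀` is the coradical and
`Cₙ₊₁ = Δ⁻¹(C₀ ⊗ C + C ⊗ Cₙ)`. -/
def coradicalFiltration : ℕ → Submodule k C
  | 0 => coradical k C
  | n + 1 => (tensorSub k (coradical k C) ⊤ ⊔ tensorSub k ⊤ (coradicalFiltration n)).comap
      (Coalgebra.comul (R := k) (A := C))

/-- `e` is a standard (comatrix) basis of `D`: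
`Δ(eᵢⱼ) = ∑ₗ eᵢₗ ⊗ eₗⱼ` and `ε(eᵢⱼ) = δᵢⱼ`. -/
structure IsStandardBasis (D : Submodule k C) {d : ℕ} (e : Fin d → Fin d → C) : Prop where
  linearIndependent : LinearIndependent k (fun p : Fin d × Fin d => e p.1 p.2)
  span_eq : Submodule.span k (Set.range fun p : Fin d × Fin d => e p.1 p.2) = D
  comul_eq : ∀ i j, Coalgebra.comul (R := k) (e i j) = ∑ l, e i l ⊗ₜ[k] e l j
  counit_eq : ∀ i j, Coalgebra.counit (R := k) (e i j) = if i = j then 1 else 0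

/-- Let `ρL, ρR` be left and right coactions on `C`. The subspace `V` is a subbicomodule
isomorphic to `V_D^* ⊗ V_E`, where for standard bases `e` of `D` and `e'` of `E`, `V_D^*` is the
left comodule with basis `e_{i1}` and `V_E` is the right comodule with basis `e'_{1j}`.
The vectors `w i j` are the images of `e_{i1} ⊗ e'_{1j}` under a bicomodule isomorphism onto `V`.
(For simple `D`, `E` with standard bases, such a `V` is automatically a simple bicomodule, and the
choice of the standard bases does not matter.) -/
def IsIsoOuterTensor (ρL ρR : C →ₗ[k] C ⊗[k] C) (D E V : Submodule k C) : Prop :=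
  ∃ (m n : ℕ) (e : Fin m → Fin m → C) (e' : Fin n → Fin n → C) (w : Fin m → Fin n → C),
    IsStandardBasis k D e ∧ IsStandardBasis k E e' ∧
    LinearIndependent k (fun p : Fin m × Fin n => w p.1 p.2) ∧
    Submodule.span k (Set.range fun p : Fin m × Fin n => w p.1 p.2) = V ∧
    (∀ i j, ρL (w i j) = ∑ l, e i l ⊗ₜ[k] w l j) ∧
    (∀ i j, ρR (w i j) = ∑ l, w i l ⊗ₜ[k] e' l j)

/-- `M^{D,E}`: the sum of the subbicomodules of `M` isomorphic to `V_D^* ⊗ V_E`. -/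
def isotypic (ρL ρR : C →ₗ[k] C ⊗[k] C) (M D E : Submodule k C) : Submodule k C :=
  sSup {V : Submodule k C | V ≤ M ∧ IsIsoOuterTensor k ρL ρR D E V}

variable {k}

/-- The projection `π : C → C₀ ⊆ C` onto the coradical with kernel `I`. -/
def proj {I : Submodule k C} (h : IsCompl (coradical k C) I) : C →ₗ[k] C :=
  (coradical k C).subtype ∘ₗ Submodule.projectionOnto (coradical k C) I h

/-- The left coaction `ρ_L = (π ⊗ id) Δ`. -/
def rhoL {I : Submodule k C} (h : IsCompl (coradical k C) I) : C →ₗ[k] C ⊗[k] C :=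
  (proj h).rTensor C ∘ₗ Coalgebra.comul

/-- The right coaction `ρ_R = (id ⊗ π) Δ`. -/
def rhoR {I : Submodule k C} (h : IsCompl (coradical k C) I) : C →ₗ[k] C ⊗[k] C :=
  (proj h).lTensor C ∘ₗ Coalgebra.comul

/-- `M` is a `C₀`-subbicomodule of `(C, ρ_L, ρ_R)`. -/
def IsSubbicomodule {I : Submodule k C} (h : IsCompl (coradical k C) I)
    (M : Submodule k C) : Prop :=
  M.map (rhoL h) ≤ tensorSub k (coradical k C) M ∧
  M.map (rhoR h) ≤ tensorSub k M (coradical k C)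

variable (k C) in
/-- The choices from which a block system of `C` is derived: a coideal `I` with `C = C₀ ⊕ I`, and,
with `Pₙ = Cₙ ∩ I`, for each `n ≥ 1` a `C₀`-subbicomodule `Qₙ` with `Pₙ = Pₙ₋₁ ⊕ Qₙ`.
Here `Q n` stands for `Qₙ₊₁`. -/
structure BlockSystem where
  I : Submodule k C
  isCoideal : I.IsCoideal
  isCompl : IsCompl (coradical k C) I
  Q : ℕ → Submodule k C
  isSubbicomodule : ∀ n, IsSubbicomodule isCompl (Q n)
  disjoint : ∀ n, Disjoint (coradicalFiltration k C n ⊓ I) (Q n)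
  sup_eq : ∀ n, (coradicalFiltration k C n ⊓ I) ⊔ Q n = coradicalFiltration k C (n + 1) ⊓ I

/-- The block `Bₙ^{d₁,d₂}`. A simple subcoalgebra `D` has degree `d` if `dim D = d²`.
`B₀^{d,d}` is the sum of the simple subcoalgebras of degree `d`, `B₀^{d₁,d₂} = 0` for `d₁ ≠ d₂`,
and for `n ≥ 1` the block `Bₙ^{d₁,d₂}` is the sum of the `Qₙ^{D,E}` over all simple subcoalgebras
`D` of degree `d₁` and `E` of degree `d₂`. -/
def BlockSystem.block (S : BlockSystem k C) : ℕ → ℕ → ℕ → Submodule k C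
  | 0, d₁, d₂ =>
    if d₁ = d₂ then
      sSup {D : Submodule k C | IsSimpleSubcoalgebra k D ∧ Module.finrank k D = d₁ ^ 2}
    else ⊥
  | n + 1, d₁, d₂ =>
    sSup {M : Submodule k C | ∃ D E : Submodule k C,
      (IsSimpleSubcoalgebra k D ∧ Module.finrank k D = d₁ ^ 2) ∧
      (IsSimpleSubcoalgebra k E ∧ Module.finrank k E = d₂ ^ 2) ∧
      M = isotypic k (rhoL S.isCompl) (rhoR S.isCompl) (S.Q n) D E}

end Coalgebra

end HopfBlocks

end

/-! Right multiplication by a group-like `g` is a coalgebra automorphism `R_g` of `H`. The core is a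
trace argument: if a left coideal `X` is stable under all `R_g`, then |G(H)| divides dim `X`. The
Galois map `h ⊗ x ↦ h x₁ ⊗ x₂` restricts to an automorphism of `H ⊗ X` conjugating `id ⊗ R_g` to
`R_g ⊗ R_g`, so dim `H` · tr_X(`R_g`) = tr_H(`R_g`) · tr_X(`R_g`). If tr_X(`R_g`) ≠ 0, then
tr_H(`R_g`) = dim `H`; as `R_g` has finite order, it is the identity and `g = 1`. Hence the
character of G(H) on `X` vanishes off `1`, and averaging it gives the divisibility
(`card_groupLike_dvd_finrank`).

A block with `n ≥ 1` need be neither a left coideal nor stable, since the complements `Qₙ` are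
chosen arbitrarily. Its sum with the preceding filtration term is both, because modulo that term `Δ`
agrees with the coaction and automorphisms permute the isotypic pieces. The sum is direct, so the
result follows by subtracting dimensions. -/

noncomputable section

namespace HopfBlocks

section Coalgebra

variable {k : Type*} [Field k] {C : Type*} [AddCommGroup C] [Module k C]

open LinearMap TensorProduct

/-! ### Subspaces of the tensor square and kernels of tensor products of maps. -/

lemma tensorSub_mono {A A' B B' : Submodule k C} (hA : A ≤ A') (hB : B ≤ B') :
    tensorSub k A B ≤ tensorSub k A' B' :=
  TensorProduct.range_map_mono (by simpa using hA) (by simpa using hB)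

lemma tmul_mem_tensorSub {A B : Submodule k C} {a b : C} (ha : a ∈ A) (hb : b ∈ B) :
    a ⊗ₜ[k] b ∈ tensorSub k A B :=
  ⟨(⟨a, ha⟩ : A) ⊗ₜ (⟨b, hb⟩ : B), by simp⟩

lemma tensorSub_le_iff {A B : Submodule k C} {P : Submodule k (C ⊗[k] C)} :
    tensorSub k A B ≤ P ↔ ∀ a ∈ A, ∀ b ∈ B, a ⊗ₜ[k] b ∈ P := by
  refine ⟨fun h a ha b hb => h (tmul_mem_tensorSub ha hb), fun h => ?_⟩
  rintro _ ⟨x, rfl⟩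
  induction x with
  | zero => simp
  | tmul a b => simpa using h a a.2 b b.2
  | add x y hx hy => rw [map_add]; exact add_mem hx hy

lemma tensorSub_map_le (f : C →ₗ[k] C) {A A' B B' : Submodule k C}
    (hA : A ≤ A'.comap f) (hB : B ≤ B'.comap f) :
    tensorSub k A B ≤ (tensorSub k A' B').comap (TensorProduct.map f f) := by
  rw [tensorSub_le_iff]
  exact fun a ha b hb => tmul_mem_tensorSub (hA ha) (hB hb)

lemma tensorSub_sup_eq_ker {M N : Type*} [AddCommGroup M] [Module k M] [AddCommGroup N] [Module k N]
    (f : C →ₗ[k] M) (g : C →ₗ[k] N) (hf : Function.Surjective f) (hg : Function.Surjective g) :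
    tensorSub k (ker f) ⊤ ⊔ tensorSub k ⊤ (ker g) = ker (TensorProduct.map f g) := by
  rw [TensorProduct.map_ker (g := f) (f := (ker f).subtype) (g' := g) (f' := (ker g).subtype)
    (by rw [LinearMap.exact_iff]; simp) hf (by rw [LinearMap.exact_iff]; simp) hg, sup_comm]
  congr 1 <;> apply le_antisymm
  · rw [tensorSub_le_iff]
    exact fun a _ b hb => ⟨a ⊗ₜ ⟨b, hb⟩, by simp⟩
  · rintro _ ⟨x, rfl⟩
    induction x with
    | zero => simp
    | tmul a b => exact tmul_mem_tensorSub trivial b.2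
    | add x y hx hy => rw [map_add]; exact add_mem hx hy
  · rw [tensorSub_le_iff]
    exact fun a ha b _ => ⟨⟨a, ha⟩ ⊗ₜ b, by simp⟩
  · rintro _ ⟨x, rfl⟩
    induction x with
    | zero => simp
    | tmul a b => exact tmul_mem_tensorSub a.2 trivial
    | add x y hx hy => rw [map_add]; exact add_mem hx hy

lemma tensorSub_mkQ_sup (A B : Submodule k C) :
    tensorSub k A ⊤ ⊔ tensorSub k ⊤ B = ker (TensorProduct.map A.mkQ B.mkQ) := by
  simpa using tensorSub_sup_eq_ker A.mkQ B.mkQ A.mkQ_surjective B.mkQ_surjective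

lemma tensorSub_bot_left (A : Submodule k C) : tensorSub k ⊥ A = ⊥ := by
  rw [eq_bot_iff, tensorSub_le_iff]; rintro a rfl b _; simp

lemma tensorSub_bot_right (A : Submodule k C) : tensorSub k A ⊥ = ⊥ := by
  rw [eq_bot_iff, tensorSub_le_iff]; rintro a _ b rfl; simp

lemma exists_comp_eq_of_ker_le {V M N : Type*} [AddCommGroup V] [Module k V]
    [AddCommGroup M] [Module k M] [AddCommGroup N] [Module k N]
    {f : V →ₗ[k] M} {g : V →ₗ[k] N} (h : ker f ≤ ker g) : ∃ i : M →ₗ[k] N, i ∘ₗ f = g := by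
  obtain ⟨j, hj⟩ := ((ker f).liftQ f le_rfl).exists_leftInverse_of_injective
    (Submodule.ker_liftQ_eq_bot _ _ _ le_rfl)
  refine ⟨(ker f).liftQ g h ∘ₗ j, LinearMap.ext fun x => ?_⟩
  have := LinearMap.congr_fun hj ((ker f).mkQ x)
  simp only [LinearMap.comp_apply, Submodule.mkQ_apply, Submodule.liftQ_apply,
    LinearMap.id_apply] at this ⊢
  rw [this, Submodule.liftQ_apply]

/-- Over a field a map factors through any map with smaller kernel. So the kernel of a tensor
product of maps depends only on the kernels of the factors, which allows the quotient map by a wedge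
to be traded for the map that defines the wedge. -/
lemma ker_map_le_ker_map {L M N P : Type*} [AddCommGroup L] [Module k L]
    [AddCommGroup M] [Module k M] [AddCommGroup N] [Module k N] [AddCommGroup P] [Module k P]
    {D : Type*} [AddCommGroup D] [Module k D]
    {f : C →ₗ[k] M} {f' : C →ₗ[k] N} {g : D →ₗ[k] L} {g' : D →ₗ[k] P}
    (hf : ker f ≤ ker f') (hg : ker g ≤ ker g') :
    ker (TensorProduct.map f g) ≤ ker (TensorProduct.map f' g') := by
  obtain ⟨i, rfl⟩ : ∃ i, i ∘ₗ f = f' := exists_comp_eq_of_ker_le hf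
  obtain ⟨j, rfl⟩ : ∃ j, j ∘ₗ g = g' := exists_comp_eq_of_ker_le hg
  rw [TensorProduct.map_comp]
  exact LinearMap.ker_le_ker_comp _ _

lemma tensorSub_top_left_eq_ker (B : Submodule k C) :
    tensorSub k ⊤ B = ker (TensorProduct.map (LinearMap.id : C →ₗ[k] C) B.mkQ) := by
  have := tensorSub_sup_eq_ker (LinearMap.id : C →ₗ[k] C) B.mkQ Function.surjective_id
    B.mkQ_surjective
  simpa [tensorSub_bot_left] using this

lemma tensorSub_top_right_eq_ker (A : Submodule k C) :
    tensorSub k A ⊤ = ker (TensorProduct.map A.mkQ (LinearMap.id : C →ₗ[k] C)) := by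
  have := tensorSub_sup_eq_ker A.mkQ (LinearMap.id : C →ₗ[k] C) A.mkQ_surjective
    Function.surjective_id
  simpa [tensorSub_bot_right] using this

/-! ### Wedges, coideals and the coradical filtration. -/

variable [Coalgebra k C]

local notation "Δ" => Coalgebra.comul (R := k) (A := C)

/-- The wedge `A ∧ B = Δ⁻¹(A ⊗ C + C ⊗ B)` of two subspaces. -/
def wedge (A B : Submodule k C) : Submodule k C :=
  (tensorSub k A ⊤ ⊔ tensorSub k ⊤ B).comap Δ

/-- `X` is a left coideal: `Δ(X) ⊆ C ⊗ X`. -/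
def IsLeftCoideal (X : Submodule k C) : Prop := X ≤ (tensorSub k ⊤ X).comap Δ

/-- `X` is a right coideal: `Δ(X) ⊆ X ⊗ C`. -/
def IsRightCoideal (X : Submodule k C) : Prop := X ≤ (tensorSub k X ⊤).comap Δ

lemma wedge_eq_ker (A B : Submodule k C) :
    wedge A B = ker (TensorProduct.map A.mkQ B.mkQ ∘ₗ Δ) := by
  rw [wedge, tensorSub_mkQ_sup, LinearMap.ker_comp]

/-- Coassociativity, with a linear map applied to each of the three legs. -/
lemma assoc_map_map_comul {M N P : Type*} [AddCommGroup M] [Module k M]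
    [AddCommGroup N] [Module k N] [AddCommGroup P] [Module k P]
    (f : C →ₗ[k] M) (g : C →ₗ[k] N) (h : C →ₗ[k] P) (x : C) :
    TensorProduct.assoc k M N P (TensorProduct.map (TensorProduct.map f g ∘ₗ Δ) h (Δ x)) =
      TensorProduct.map f (TensorProduct.map g h ∘ₗ Δ) (Δ x) := by
  have h1 : TensorProduct.map (TensorProduct.map f g ∘ₗ Δ) h (Δ x) =
      TensorProduct.map (TensorProduct.map f g) h (Coalgebra.comul.rTensor C (Δ x)) := by
    rw [← LinearMap.map_comp_rTensor, LinearMap.comp_apply]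
  have h2 : TensorProduct.map f (TensorProduct.map g h ∘ₗ Δ) (Δ x) =
      TensorProduct.map f (TensorProduct.map g h) (Coalgebra.comul.lTensor C (Δ x)) := by
    rw [← LinearMap.map_comp_lTensor, LinearMap.comp_apply]
  rw [h1, h2, ← Coalgebra.coassoc_apply]
  exact (LinearMap.congr_fun (TensorProduct.map_map_comp_assoc_eq f g h) _).symm

/-- Both sides are the kernel of the twice iterated comultiplication followed by the three quotient
maps. -/
lemma wedge_assoc (A B D : Submodule k C) : wedge (wedge A B) D = wedge A (wedge B D) := by
  ext x
  have h1 : ker (TensorProduct.map (wedge A B).mkQ D.mkQ) =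
      ker (TensorProduct.map (TensorProduct.map A.mkQ B.mkQ ∘ₗ Δ) D.mkQ) := by
    apply le_antisymm <;> apply ker_map_le_ker_map <;> simp [← wedge_eq_ker]
  have h2 : ker (TensorProduct.map A.mkQ (wedge B D).mkQ) =
      ker (TensorProduct.map A.mkQ (TensorProduct.map B.mkQ D.mkQ ∘ₗ Δ)) := by
    apply le_antisymm <;> apply ker_map_le_ker_map <;> simp [← wedge_eq_ker]
  rw [wedge_eq_ker (wedge A B), wedge_eq_ker A (wedge B D), LinearMap.ker_comp,
    LinearMap.ker_comp, h1, h2]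
  simp only [Submodule.mem_comap, LinearMap.mem_ker]
  rw [← assoc_map_map_comul, LinearEquiv.map_eq_zero_iff]

/-- By coassociativity the condition reads `((id ⊗ p_A)Δ ⊗ p_B)Δ x = 0`, where `p_A`, `p_B` are the
quotient maps. It follows from `(p_A ⊗ p_B)Δ x = 0`, because `(id ⊗ p_A)Δ` kills `A`. -/
lemma IsLeftCoideal.wedge {A : Submodule k C} (hA : IsLeftCoideal A) (B : Submodule k C) :
    IsLeftCoideal (wedge A B) := by
  intro x hx
  have h1 : ker (TensorProduct.map LinearMap.id (HopfBlocks.wedge A B).mkQ) =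
      ker (TensorProduct.map (LinearMap.id : C →ₗ[k] C)
        (TensorProduct.map A.mkQ B.mkQ ∘ₗ Δ)) := by
    apply le_antisymm <;> apply ker_map_le_ker_map <;> simp [← wedge_eq_ker]
  rw [Submodule.mem_comap, tensorSub_top_left_eq_ker, h1, LinearMap.mem_ker,
    ← assoc_map_map_comul, LinearEquiv.map_eq_zero_iff]
  rw [IsLeftCoideal, tensorSub_top_left_eq_ker, ← LinearMap.ker_comp] at hA
  rw [wedge_eq_ker, LinearMap.ker_comp] at hx
  exact ker_map_le_ker_map (by simpa using hA) le_rfl hx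

lemma IsRightCoideal.wedge {B : Submodule k C} (hB : IsRightCoideal B) (A : Submodule k C) :
    IsRightCoideal (wedge A B) := by
  intro x hx
  have h1 : ker (TensorProduct.map (HopfBlocks.wedge A B).mkQ LinearMap.id) =
      ker (TensorProduct.map (TensorProduct.map A.mkQ B.mkQ ∘ₗ Δ)
        (LinearMap.id : C →ₗ[k] C)) := by
    apply le_antisymm <;> apply ker_map_le_ker_map <;> simp [← wedge_eq_ker]
  rw [Submodule.mem_comap, tensorSub_top_right_eq_ker, h1, LinearMap.mem_ker,
    ← LinearEquiv.map_eq_zero_iff (TensorProduct.assoc k _ _ _), assoc_map_map_comul]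
  rw [IsRightCoideal, tensorSub_top_right_eq_ker, ← LinearMap.ker_comp] at hB
  rw [wedge_eq_ker, LinearMap.ker_comp] at hx
  exact ker_map_le_ker_map le_rfl (by simpa using hB) hx

lemma wedge_mono {A A' B B' : Submodule k C} (hA : A ≤ A') (hB : B ≤ B') :
    wedge A B ≤ wedge A' B' :=
  Submodule.comap_mono (sup_le_sup (tensorSub_mono hA le_rfl) (tensorSub_mono le_rfl hB))

lemma IsLeftCoideal.sSup {s : Set (Submodule k C)} (hs : ∀ X ∈ s, IsLeftCoideal X) :
    IsLeftCoideal (sSup s) :=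
  sSup_le fun X hX => (hs X hX).trans (Submodule.comap_mono (tensorSub_mono le_rfl (le_sSup hX)))

lemma IsRightCoideal.sSup {s : Set (Submodule k C)} (hs : ∀ X ∈ s, IsRightCoideal X) :
    IsRightCoideal (sSup s) :=
  sSup_le fun X hX => (hs X hX).trans (Submodule.comap_mono (tensorSub_mono (le_sSup hX) le_rfl))

lemma IsSubcoalgebra.isLeftCoideal {D : Submodule k C} (hD : IsSubcoalgebra k D) :
    IsLeftCoideal D :=
  (Submodule.map_le_iff_le_comap.1 hD).trans (Submodule.comap_mono (tensorSub_mono le_top le_rfl))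

lemma IsSubcoalgebra.isRightCoideal {D : Submodule k C} (hD : IsSubcoalgebra k D) :
    IsRightCoideal D :=
  (Submodule.map_le_iff_le_comap.1 hD).trans (Submodule.comap_mono (tensorSub_mono le_rfl le_top))

variable (k C) in
lemma isLeftCoideal_coradical : IsLeftCoideal (coradical k C) :=
  IsLeftCoideal.sSup fun _ h => h.1.isLeftCoideal

variable (k C) in
lemma isRightCoideal_coradical : IsRightCoideal (coradical k C) :=
  IsRightCoideal.sSup fun _ h => h.1.isRightCoideal

lemma coradicalFiltration_succ (n : ℕ) : coradicalFiltration k C (n + 1) =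
    wedge (coradical k C) (coradicalFiltration k C n) := rfl

/-- The mirrored recursion gives the right-hand versions: the right coideal property and the
comparison of `Δ` with `ρ_R`. -/
lemma coradicalFiltration_succ' (n : ℕ) : coradicalFiltration k C (n + 1) =
    wedge (coradicalFiltration k C n) (coradical k C) := by
  induction n with
  | zero => rfl
  | succ n ih =>
    rw [coradicalFiltration_succ, ih, ← wedge_assoc, ← coradicalFiltration_succ, ← ih]

variable (k C) in
lemma isLeftCoideal_coradicalFiltration : ∀ n, IsLeftCoideal (coradicalFiltration k C n)
  | 0 => isLeftCoideal_coradical k C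
  | _ + 1 => (isLeftCoideal_coradical k C).wedge _

variable (k C) in
lemma isRightCoideal_coradicalFiltration : ∀ n, IsRightCoideal (coradicalFiltration k C n)
  | 0 => isRightCoideal_coradical k C
  | n + 1 => by
    rw [coradicalFiltration_succ']
    exact (isRightCoideal_coradical k C).wedge _

lemma coradicalFiltration_le_succ (n : ℕ) :
    coradicalFiltration k C n ≤ coradicalFiltration k C (n + 1) := by
  induction n with
  | zero =>
    exact (isLeftCoideal_coradical k C).trans (Submodule.comap_mono le_sup_right)
  | succ n ih => exact wedge_mono le_rfl ih

lemma coradical_le_coradicalFiltration (n : ℕ) :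
    coradical k C ≤ coradicalFiltration k C n := by
  induction n with
  | zero => exact le_rfl
  | succ n ih => exact ih.trans (coradicalFiltration_le_succ n)

/-! ### Coalgebra automorphisms -/

lemma comul_coalgEquiv (φ : C ≃ₗc[k] C) (x : C) :
    Δ (φ x) = TensorProduct.map (φ : C →ₗ[k] C) (φ : C →ₗ[k] C) (Δ x) :=
  (CoalgHomClass.map_comp_comul_apply φ x).symm

lemma wedge_le_comap (φ : C ≃ₗc[k] C) {A B : Submodule k C}
    (hA : A ≤ A.comap (φ : C →ₗ[k] C)) (hB : B ≤ B.comap (φ : C →ₗ[k] C)) :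
    wedge A B ≤ (wedge A B).comap (φ : C →ₗ[k] C) := by
  intro x hx
  change Δ (φ x) ∈ tensorSub k A ⊤ ⊔ tensorSub k ⊤ B
  rw [comul_coalgEquiv]
  exact sup_le ((tensorSub_map_le _ hA le_top).trans (Submodule.comap_mono le_sup_left))
    ((tensorSub_map_le _ le_top hB).trans (Submodule.comap_mono le_sup_right)) hx

lemma IsSubcoalgebra.map {D : Submodule k C} (hD : IsSubcoalgebra k D) (φ : C ≃ₗc[k] C) :
    IsSubcoalgebra k (D.map (φ : C →ₗ[k] C)) := by
  rintro _ ⟨_, ⟨x, hx, rfl⟩, rfl⟩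
  change Δ (φ x) ∈ tensorSub k _ _
  rw [comul_coalgEquiv]
  exact tensorSub_map_le _ (Submodule.le_comap_map _ _) (Submodule.le_comap_map _ _)
    (hD ⟨x, hx, rfl⟩)

lemma map_symm_map (φ : C ≃ₗc[k] C) (D : Submodule k C) :
    (D.map (φ : C →ₗ[k] C)).map (φ.symm : C →ₗ[k] C) = D := by
  ext x; simp [Submodule.mem_map]

lemma map_map_symm (φ : C ≃ₗc[k] C) (D : Submodule k C) :
    (D.map (φ.symm : C →ₗ[k] C)).map (φ : C →ₗ[k] C) = D := by
  ext x; simp [Submodule.mem_map]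

lemma IsSimpleSubcoalgebra.map {D : Submodule k C} (hD : IsSimpleSubcoalgebra k D)
    (φ : C ≃ₗc[k] C) : IsSimpleSubcoalgebra k (D.map (φ : C →ₗ[k] C)) := by
  refine ⟨hD.1.map φ, fun h => hD.2.1 ?_, fun E hE hED => ?_⟩
  · rw [← map_symm_map φ D, h, Submodule.map_bot]
  · have := hD.2.2 _ (hE.map φ.symm) (by
      rw [← map_symm_map φ D]; exact Submodule.map_mono hED)
    rw [← map_map_symm φ E]
    exact this.imp (fun h => by rw [h, Submodule.map_bot]) (fun h => by rw [h])

lemma finrank_map_coalgEquiv (φ : C ≃ₗc[k] C) (D : Submodule k C) :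
    Module.finrank k (D.map (φ : C →ₗ[k] C)) = Module.finrank k D :=
  LinearEquiv.finrank_map_eq φ.toLinearEquiv D

lemma coradicalFiltration_le_comap (φ : C ≃ₗc[k] C) (n : ℕ) :
    coradicalFiltration k C n ≤ (coradicalFiltration k C n).comap (φ : C →ₗ[k] C) := by
  have h0 : coradical k C ≤ (coradical k C).comap (φ : C →ₗ[k] C) :=
    sSup_le fun D hD => Submodule.map_le_iff_le_comap.1 (le_sSup (hD.map φ))
  induction n with
  | zero => exact h0
  | succ n ih => exact wedge_le_comap φ h0 ih

lemma IsStandardBasis.map {D : Submodule k C} {d : ℕ} {e : Fin d → Fin d → C}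
    (he : IsStandardBasis k D e) (φ : C ≃ₗc[k] C) :
    IsStandardBasis k (D.map (φ : C →ₗ[k] C)) (fun i j => φ (e i j)) where
  linearIndependent := he.linearIndependent.map' (φ : C →ₗ[k] C)
    (LinearMap.ker_eq_bot.2 φ.injective)
  span_eq := by
    rw [← he.span_eq, Submodule.map_span, ← Set.range_comp]; rfl
  comul_eq i j := by rw [comul_coalgEquiv, he.comul_eq, map_sum]; rfl
  counit_eq i j := by rw [← he.counit_eq]; exact CoalgHomClass.counit_comp_apply φ _

end Coalgebra
end HopfBlocks

namespace HopfBlocks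

/-! ### Coactions, retractions and blocks modulo the filtration. -/

section Coalgebra

variable {k : Type*} [Field k] {C : Type*} [AddCommGroup C] [Module k C]

open LinearMap TensorProduct

/-- The projection onto `Q` along `W`, extended from `W ⊔ Q` to all of `C` so that it can be
tensored with the identity of `C`. -/
lemma exists_eq_self_eq_zero_of_disjoint {W Q : Submodule k C} (h : Disjoint W Q) :
    ∃ τ : C →ₗ[k] C, (∀ x ∈ W, τ x = 0) ∧ (∀ x ∈ Q, τ x = x) ∧
      ∀ x ∈ W ⊔ Q, τ x ∈ Q ∧ x - τ x ∈ W := by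
  obtain ⟨r, hr⟩ := (W.mkQ ∘ₗ Q.subtype).exists_leftInverse_of_injective (by
    rw [LinearMap.ker_comp, Submodule.ker_mkQ, ← Submodule.disjoint_iff_comap_eq_bot]
    exact h.symm)
  have hW : ∀ x ∈ W, (Q.subtype ∘ₗ r ∘ₗ W.mkQ) x = 0 := fun x hx => by
    simp [(Submodule.Quotient.mk_eq_zero W).2 hx]
  have hQ : ∀ x ∈ Q, (Q.subtype ∘ₗ r ∘ₗ W.mkQ) x = x := fun x hx =>
    congrArg Subtype.val (LinearMap.congr_fun hr ⟨x, hx⟩)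
  refine ⟨Q.subtype ∘ₗ r ∘ₗ W.mkQ, hW, hQ, fun x hx => ⟨(r _).2, ?_⟩⟩
  obtain ⟨w, hw, q, hq, rfl⟩ := Submodule.mem_sup.1 hx
  rw [map_add, hW w hw, hQ q hq]
  simpa using hw

lemma lTensor_eq_self {f : C →ₗ[k] C} {A B : Submodule k C} (hf : ∀ x ∈ B, f x = x)
    {y : C ⊗[k] C} (hy : y ∈ tensorSub k A B) : f.lTensor C y = y := by
  have : tensorSub k A B ≤ ker (f.lTensor C - LinearMap.id) :=
    tensorSub_le_iff.2 fun a _ b hb => by simp [hf b hb]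
  simpa [sub_eq_zero] using this hy

lemma rTensor_eq_self {f : C →ₗ[k] C} {A B : Submodule k C} (hf : ∀ x ∈ A, f x = x)
    {y : C ⊗[k] C} (hy : y ∈ tensorSub k A B) : f.rTensor C y = y := by
  have : tensorSub k A B ≤ ker (f.rTensor C - LinearMap.id) :=
    tensorSub_le_iff.2 fun a ha b _ => by simp [hf a ha]
  simpa [sub_eq_zero] using this hy

lemma lTensor_eq_zero {f : C →ₗ[k] C} {A B : Submodule k C} (hf : ∀ x ∈ B, f x = 0)
    {y : C ⊗[k] C} (hy : y ∈ tensorSub k A B) : f.lTensor C y = 0 := by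
  have : tensorSub k A B ≤ ker (f.lTensor C) :=
    tensorSub_le_iff.2 fun a _ b hb => by simp [hf b hb]
  exact this hy

lemma rTensor_eq_zero {f : C →ₗ[k] C} {A B : Submodule k C} (hf : ∀ x ∈ A, f x = 0)
    {y : C ⊗[k] C} (hy : y ∈ tensorSub k A B) : f.rTensor C y = 0 := by
  have : tensorSub k A B ≤ ker (f.rTensor C) :=
    tensorSub_le_iff.2 fun a ha b _ => by simp [hf a ha]
  exact this hy

variable [Coalgebra k C]

local notation "Δ" => Coalgebra.comul (R := k) (A := C)

section Coactions

variable {I : Submodule k C} (h : IsCompl (coradical k C) I)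

lemma proj_apply_of_mem {x : C} (hx : x ∈ coradical k C) : proj h x = x :=
  congrArg Subtype.val (Submodule.projectionOnto_apply_left h ⟨x, hx⟩)

/-- Since `π` is the identity on `C₀`, the part of `Δ x` in `C₀ ⊗ C` cancels. -/
lemma comul_sub_rhoL_mem {n : ℕ} {x : C} (hx : x ∈ coradicalFiltration k C (n + 1)) :
    Δ x - rhoL h x ∈ tensorSub k ⊤ (coradicalFiltration k C n) := by
  have : tensorSub k (coradical k C) ⊤ ⊔ tensorSub k ⊤ (coradicalFiltration k C n) ≤
      (tensorSub k ⊤ (coradicalFiltration k C n)).comap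
        (LinearMap.id - (proj h).rTensor C) := by
    refine sup_le ?_ ?_ <;> rw [tensorSub_le_iff] <;> intro a ha b hb
    · simp [proj_apply_of_mem h ha]
    · exact sub_mem (tmul_mem_tensorSub Submodule.mem_top hb) (tmul_mem_tensorSub Submodule.mem_top hb)
  exact this hx

lemma comul_sub_rhoR_mem {n : ℕ} {x : C} (hx : x ∈ coradicalFiltration k C (n + 1)) :
    Δ x - rhoR h x ∈ tensorSub k (coradicalFiltration k C n) ⊤ := by
  have : tensorSub k (coradicalFiltration k C n) ⊤ ⊔ tensorSub k ⊤ (coradical k C) ≤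
      (tensorSub k (coradicalFiltration k C n) ⊤).comap
        (LinearMap.id - (proj h).lTensor C) := by
    refine sup_le ?_ ?_ <;> rw [tensorSub_le_iff] <;> intro a ha b hb
    · exact sub_mem (tmul_mem_tensorSub ha Submodule.mem_top) (tmul_mem_tensorSub ha Submodule.mem_top)
    · simp [proj_apply_of_mem h hb]
  rw [coradicalFiltration_succ'] at hx
  exact this hx

end Coactions

namespace BlockSystem

variable (S : BlockSystem k C)

lemma Q_le_filtration (n : ℕ) : S.Q n ≤ coradicalFiltration k C (n + 1) :=
  le_sup_right.trans ((S.sup_eq n).le.trans inf_le_left)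

lemma Q_le_I (n : ℕ) : S.Q n ≤ S.I :=
  le_sup_right.trans ((S.sup_eq n).le.trans inf_le_right)

lemma disjoint_filtration_Q (n : ℕ) : Disjoint (coradicalFiltration k C n) (S.Q n) := by
  rw [Submodule.disjoint_def]
  exact fun x hx hxQ => Submodule.disjoint_def.1 (S.disjoint n) x ⟨hx, S.Q_le_I n hxQ⟩ hxQ

/-- As `C₀` lies in every filtration term, the `I`-component of an element of `Cₙ₊₁` stays in
`Cₙ₊₁`. -/
lemma filtration_sup_Q (n : ℕ) :
    coradicalFiltration k C n ⊔ S.Q n = coradicalFiltration k C (n + 1) := by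
  apply le_antisymm (sup_le (coradicalFiltration_le_succ n) (S.Q_le_filtration n))
  intro x hx
  obtain ⟨c, hc, i, hi, rfl⟩ :=
    Submodule.mem_sup.1 (S.isCompl.sup_eq_top.ge (Submodule.mem_top (x := x)))
  have hi' : i ∈ coradicalFiltration k C (n + 1) ⊓ S.I :=
    ⟨by simpa using sub_mem hx (coradical_le_coradicalFiltration (n + 1) hc), hi⟩
  rw [← S.sup_eq n] at hi'
  have hle : coradicalFiltration k C n ⊓ S.I ⊔ S.Q n ≤ coradicalFiltration k C n ⊔ S.Q n :=
    sup_le_sup_right inf_le_left _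
  exact add_mem (Submodule.mem_sup_left (coradical_le_coradicalFiltration n hc)) (hle hi')

variable {S} {n : ℕ} {τ : C →ₗ[k] C}
  (hW : ∀ x ∈ coradicalFiltration k C n, τ x = 0) (hQ : ∀ x ∈ S.Q n, τ x = x)
  (hτ : ∀ x ∈ coradicalFiltration k C n ⊔ S.Q n, τ x ∈ S.Q n ∧ x - τ x ∈ coradicalFiltration k C n)
include hW hQ hτ

/-- `Q n` is a model of the quotient `Cₙ₊₁ / Cₙ`, on which `Δ` induces the left coaction; `τ` plays
the role of the quotient map. -/
lemma rhoL_retract {x : C} (hx : x ∈ coradicalFiltration k C (n + 1)) :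
    rhoL S.isCompl (τ x) = τ.lTensor C (Δ x) := by
  obtain ⟨h1, h2⟩ := hτ x (by rwa [filtration_sup_Q])
  have h3 := lTensor_eq_zero hW (isLeftCoideal_coradicalFiltration k C n h2)
  have h4 := lTensor_eq_zero hW (comul_sub_rhoL_mem S.isCompl (S.Q_le_filtration n h1))
  have h5 := lTensor_eq_self hQ ((S.isSubbicomodule n).1 ⟨_, h1, rfl⟩)
  rw [map_sub, map_sub, sub_eq_zero] at h3
  rw [map_sub, sub_eq_zero, h5] at h4
  rw [h3, h4]

lemma rhoR_retract {x : C} (hx : x ∈ coradicalFiltration k C (n + 1)) :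
    rhoR S.isCompl (τ x) = τ.rTensor C (Δ x) := by
  obtain ⟨h1, h2⟩ := hτ x (by rwa [filtration_sup_Q])
  have h3 := rTensor_eq_zero hW (isRightCoideal_coradicalFiltration k C n h2)
  have h4 := rTensor_eq_zero hW (comul_sub_rhoR_mem S.isCompl (S.Q_le_filtration n h1))
  have h5 := rTensor_eq_self hQ ((S.isSubbicomodule n).2 ⟨_, h1, rfl⟩)
  rw [map_sub, map_sub, sub_eq_zero] at h3
  rw [map_sub, sub_eq_zero, h5] at h4
  rw [h3, h4]

/-- A coalgebra automorphism, followed by the retraction onto `Q n`, turns a subbicomodule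
isomorphic to `V_D^* ⊗ V_E` into one isomorphic to `V_{φ D}^* ⊗ V_{φ E}`. -/
lemma IsIsoOuterTensor_map {D E V : Submodule k C} (hV : V ≤ S.Q n)
    (h : IsIsoOuterTensor k (rhoL S.isCompl) (rhoR S.isCompl) D E V) (φ : C ≃ₗc[k] C) :
    V.map (τ ∘ₗ (φ : C →ₗ[k] C)) ≤ S.Q n ∧
    IsIsoOuterTensor k (rhoL S.isCompl) (rhoR S.isCompl) (D.map (φ : C →ₗ[k] C))
      (E.map (φ : C →ₗ[k] C)) (V.map (τ ∘ₗ (φ : C →ₗ[k] C))) := by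
  have hφ : ∀ x ∈ V, φ x ∈ coradicalFiltration k C (n + 1) := fun x hx =>
    coradicalFiltration_le_comap φ (n + 1) (S.Q_le_filtration n (hV hx))
  constructor
  · rintro _ ⟨x, hx, rfl⟩
    exact (hτ _ (by rw [filtration_sup_Q]; exact hφ x hx)).1
  obtain ⟨m, l, e, e', w, he, he', hw, hspan, hL, hR⟩ := h
  have hwV : ∀ i j, w i j ∈ V := fun i j => hspan ▸ Submodule.subset_span ⟨(i, j), rfl⟩
  refine ⟨m, l, _, _, fun i j => τ (φ (w i j)), he.map φ, he'.map φ, ?_, ?_, fun i j => ?_,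
    fun i j => ?_⟩
  -- Injectivity on `V`: if `τ (φ x) = 0`, then `φ x` lies in `Cₙ`, hence so does `x`, and `Cₙ`
  -- meets `Q n` trivially.
  · refine hw.map (f := τ ∘ₗ (φ : C →ₗ[k] C)) ?_
    rw [hspan, Submodule.disjoint_def]
    intro x hx hx0
    have h1 := (hτ _ (by rw [filtration_sup_Q]; exact hφ x hx)).2
    rw [show τ (φ x) = 0 from hx0, sub_zero] at h1
    have h2 := coradicalFiltration_le_comap φ.symm n h1
    exact Submodule.disjoint_def.1 (S.disjoint_filtration_Q n) x (by simpa using h2) (hV hx)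
  · rw [← hspan, Submodule.map_span, ← Set.range_comp]; rfl
  · rw [rhoL_retract hW hQ hτ (hφ _ (hwV i j)), comul_coalgEquiv]
    -- The error `Δ w - ρ_L w` lies in `C ⊗ Cₙ`; `φ ⊗ φ` keeps it there and `τ` kills it.
    have h1 := comul_sub_rhoL_mem S.isCompl (S.Q_le_filtration n (hV (hwV i j)))
    have h2 := lTensor_eq_zero hW
      (tensorSub_map_le (A' := ⊤) (φ : C →ₗ[k] C) le_top (coradicalFiltration_le_comap φ n) h1)
    rw [map_sub, map_sub, sub_eq_zero] at h2
    rw [h2, hL]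
    simp
  · rw [rhoR_retract hW hQ hτ (hφ _ (hwV i j)), comul_coalgEquiv]
    have h1 := comul_sub_rhoR_mem S.isCompl (S.Q_le_filtration n (hV (hwV i j)))
    have h2 := rTensor_eq_zero hW
      (tensorSub_map_le (B' := ⊤) (φ : C →ₗ[k] C) (coradicalFiltration_le_comap φ n) le_top h1)
    rw [map_sub, map_sub, sub_eq_zero] at h2
    rw [h2, hR]
    simp

omit hW hQ hτ
variable (S)

lemma block_succ_le_Q (n d₁ d₂ : ℕ) : S.block (n + 1) d₁ d₂ ≤ S.Q n := by
  refine sSup_le ?_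
  rintro _ ⟨D, E, -, -, rfl⟩
  exact sSup_le fun V hV => hV.1

lemma le_block_succ {n d₁ d₂ : ℕ} {D E V : Submodule k C}
    (hD : IsSimpleSubcoalgebra k D ∧ Module.finrank k D = d₁ ^ 2)
    (hE : IsSimpleSubcoalgebra k E ∧ Module.finrank k E = d₂ ^ 2) (hV : V ≤ S.Q n)
    (h : IsIsoOuterTensor k (rhoL S.isCompl) (rhoR S.isCompl) D E V) :
    V ≤ S.block (n + 1) d₁ d₂ :=
  (le_sSup (show V ∈ {V : Submodule k C | V ≤ S.Q n ∧ IsIsoOuterTensor k _ _ D E V}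
    from ⟨hV, h⟩)).trans (le_sSup ⟨D, E, hD, hE, rfl⟩)

lemma block_succ_le {n d₁ d₂ : ℕ} {P : Submodule k C}
    (h : ∀ D E V : Submodule k C, (IsSimpleSubcoalgebra k D ∧ Module.finrank k D = d₁ ^ 2) →
      (IsSimpleSubcoalgebra k E ∧ Module.finrank k E = d₂ ^ 2) → V ≤ S.Q n →
      IsIsoOuterTensor k (rhoL S.isCompl) (rhoR S.isCompl) D E V → V ≤ P) :
    S.block (n + 1) d₁ d₂ ≤ P := by
  refine sSup_le ?_
  rintro _ ⟨D, E, hD, hE, rfl⟩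
  exact sSup_le fun V hV => h D E V hD hE hV.1 hV.2

/-- On a constituent `V`, `ρ_L` takes values in `C ⊗ V`, and `Δ` differs from it by a term in `C ⊗
Cₙ`. -/
lemma isLeftCoideal_filtration_sup_block (n d₁ d₂ : ℕ) :
    IsLeftCoideal (coradicalFiltration k C n ⊔ S.block (n + 1) d₁ d₂) := by
  refine sup_le ((isLeftCoideal_coradicalFiltration k C n).trans
    (Submodule.comap_mono (tensorSub_mono le_rfl le_sup_left))) ?_
  refine S.block_succ_le fun D E V hD hE hV h => ?_
  have hVB := S.le_block_succ hD hE hV h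
  obtain ⟨m, l, e, e', w, -, -, -, rfl, hL, -⟩ := h
  rw [Submodule.span_le]
  rintro _ ⟨⟨i, j⟩, rfl⟩
  have hw : ∀ i j, w i j ∈ Submodule.span k (Set.range fun p : Fin m × Fin l => w p.1 p.2) :=
    fun i j => Submodule.subset_span ⟨(i, j), rfl⟩
  have h1 := tensorSub_mono le_rfl
    (le_sup_left : _ ≤ coradicalFiltration k C n ⊔ S.block (n + 1) d₁ d₂)
    (comul_sub_rhoL_mem S.isCompl (S.Q_le_filtration n (hV (hw i j))))
  rw [hL] at h1
  simpa using add_mem h1 (Submodule.sum_mem (t := Finset.univ) _ fun c _ =>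
    tmul_mem_tensorSub (Submodule.mem_top (x := e i c)) (Submodule.mem_sup_right (hVB (hw c j))))

/-- Modulo `Cₙ`, `φ` agrees on `V` with `τ ∘ φ`, which carries the type `(D, E)` to `(φ D, φ E)`;
these have the same degrees. -/
lemma filtration_sup_block_le_comap (n d₁ d₂ : ℕ) (φ : C ≃ₗc[k] C) :
    coradicalFiltration k C n ⊔ S.block (n + 1) d₁ d₂ ≤
      (coradicalFiltration k C n ⊔ S.block (n + 1) d₁ d₂).comap (φ : C →ₗ[k] C) := by
  refine sup_le ((coradicalFiltration_le_comap φ n).trans (Submodule.comap_mono le_sup_left)) ?_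
  obtain ⟨τ, hW, hQ, hτ⟩ := exists_eq_self_eq_zero_of_disjoint (S.disjoint_filtration_Q n)
  refine S.block_succ_le fun D E V hD hE hV h => ?_
  obtain ⟨hV', h'⟩ := IsIsoOuterTensor_map hW hQ hτ hV h φ
  have hVB := S.le_block_succ ⟨hD.1.map φ, (finrank_map_coalgEquiv φ D).trans hD.2⟩
    ⟨hE.1.map φ, (finrank_map_coalgEquiv φ E).trans hE.2⟩ hV' h'
  intro x hx
  have h1 := (hτ (φ x) (by
    rw [filtration_sup_Q]
    exact coradicalFiltration_le_comap φ (n + 1) (S.Q_le_filtration n (hV hx)))).2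
  have h2 : τ (φ x) ∈ S.block (n + 1) d₁ d₂ := hVB ⟨x, hx, rfl⟩
  have := add_mem (Submodule.mem_sup_left h1) (Submodule.mem_sup_right h2)
  simpa using this

lemma isLeftCoideal_block_zero (d₁ d₂ : ℕ) : IsLeftCoideal (S.block 0 d₁ d₂) := by
  rw [block]
  split_ifs with h
  · exact IsLeftCoideal.sSup fun _ h => h.1.1.isLeftCoideal
  · exact bot_le

lemma block_zero_le_comap (d₁ d₂ : ℕ) (φ : C ≃ₗc[k] C) :
    S.block 0 d₁ d₂ ≤ (S.block 0 d₁ d₂).comap (φ : C →ₗ[k] C) := by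
  rw [block]
  split_ifs with h
  · exact sSup_le fun D hD => Submodule.map_le_iff_le_comap.1
      (le_sSup ⟨hD.1.map φ, (finrank_map_coalgEquiv φ D).trans hD.2⟩)
  · exact bot_le

lemma finrank_filtration_sup_block [FiniteDimensional k C] (n d₁ d₂ : ℕ) :
    Module.finrank k ↥(coradicalFiltration k C n ⊔ S.block (n + 1) d₁ d₂) =
      Module.finrank k (coradicalFiltration k C n) +
        Module.finrank k (S.block (n + 1) d₁ d₂) := by
  rw [← Submodule.finrank_sup_add_finrank_inf_eq,
    ((S.disjoint_filtration_Q n).mono_right (S.block_succ_le_Q n d₁ d₂)).eq_bot, finrank_bot,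
    add_zero]

/-! ### The block `B₀^{1,1}` and group-like elements. -/

lemma isSimpleSubcoalgebra_span_groupLike (g : GroupLike k C) :
    IsSimpleSubcoalgebra k (Submodule.span k {g.val}) := by
  have hg := g.isGroupLikeElem_val
  refine ⟨?_, by simpa using hg.ne_zero, fun E _ hE => ?_⟩
  · rw [IsSubcoalgebra, Submodule.map_span_le]
    rintro _ rfl
    rw [hg.comul_eq_tmul_self]
    exact tmul_mem_tensorSub (Submodule.mem_span_singleton_self _)
      (Submodule.mem_span_singleton_self _)
  · exact (nonzero_span_atom _ hg.ne_zero).le_iff.1 hE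

/-- For a spanning vector `d` one has `Δ d = c d ⊗ d`. The counit axiom forces `c ε(d) = 1`, so `c •
d` is group-like. -/
lemma exists_groupLike_of_finrank_eq_one {D : Submodule k C} (hD : IsSubcoalgebra k D)
    (h : Module.finrank k D = 1) : ∃ g : GroupLike k C, D = Submodule.span k {g.val} := by
  obtain ⟨⟨d, hd⟩, hd0, hdD⟩ := finrank_eq_one_iff'.1 h
  replace hd0 : d ≠ 0 := by simpa using hd0
  have hD' : D = Submodule.span k {d} := by
    apply le_antisymm
    · intro x hx
      obtain ⟨c, hc⟩ := hdD ⟨x, hx⟩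
      exact Submodule.mem_span_singleton.2 ⟨c, congrArg Subtype.val hc⟩
    · simpa using hd
  have h1 : tensorSub k D D ≤ Submodule.span k {d ⊗ₜ[k] d} := by
    rw [tensorSub_le_iff, hD']
    intro a ha b hb
    obtain ⟨x, rfl⟩ := Submodule.mem_span_singleton.1 ha
    obtain ⟨y, rfl⟩ := Submodule.mem_span_singleton.1 hb
    exact Submodule.mem_span_singleton.2 ⟨x * y, by rw [TensorProduct.smul_tmul_smul]⟩
  obtain ⟨c, hc⟩ := Submodule.mem_span_singleton.1 (h1 (hD ⟨d, hd, rfl⟩))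
  have h2 := congrArg (TensorProduct.lid k C)
    (congrArg (Coalgebra.counit.rTensor C) hc)
  simp only [map_smul, rTensor_tmul, TensorProduct.lid_tmul, Coalgebra.rTensor_counit_comul,
    one_smul, smul_smul] at h2
  have h3 : c * Coalgebra.counit d = 1 := by
    have : (c * Coalgebra.counit d - 1) • d = 0 := by rw [sub_smul, h2, one_smul, sub_self]
    exact sub_eq_zero.1 ((smul_eq_zero.1 this).resolve_right hd0)
  have hc0 : c ≠ 0 := left_ne_zero_of_mul_eq_one h3
  refine ⟨⟨c • d, by simpa using h3, ?_⟩, ?_⟩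
  · rw [map_smul, ← hc, TensorProduct.smul_tmul_smul, smul_smul]
  · rw [hD']
    exact (Submodule.span_singleton_smul_eq (IsUnit.mk0 c hc0) d).symm

lemma block_zero_one_one :
    S.block 0 1 1 = Submodule.span k (Set.range (GroupLike.val (R := k) (A := C))) := by
  rw [block, if_pos rfl]
  apply le_antisymm
  · refine sSup_le ?_
    rintro D ⟨hD, hD1⟩
    obtain ⟨g, rfl⟩ := exists_groupLike_of_finrank_eq_one hD.1 (by simpa using hD1)
    exact Submodule.span_mono (by rintro _ rfl; exact ⟨g, rfl⟩)
  · rw [Submodule.span_le]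
    rintro _ ⟨g, rfl⟩
    have hg : Module.finrank k (Submodule.span k {g.val}) = 1 ^ 2 := by
      rw [finrank_span_singleton g.isGroupLikeElem_val.ne_zero, one_pow]
    have hle := le_sSup (show Submodule.span k {g.val} ∈
      {D : Submodule k C | IsSimpleSubcoalgebra k D ∧ Module.finrank k D = 1 ^ 2} from
        ⟨isSimpleSubcoalgebra_span_groupLike g, hg⟩)
    exact hle (Submodule.mem_span_singleton_self _)

lemma finrank_block_zero_one_one [FiniteDimensional k C] :
    Module.finrank k (S.block 0 1 1) = Nat.card (GroupLike k C) := by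
  have hli := linearIndep_groupLikeVal (R := k) (A := C)
  have := hli.finite
  have := Fintype.ofFinite (GroupLike k C)
  rw [block_zero_one_one, finrank_span_eq_card hli, Nat.card_eq_fintype_card]

end BlockSystem

end Coalgebra
end HopfBlocks

namespace HopfBlocks

open Module

/-! ### Traces of operators of finite order. -/

section RootsOfUnity

/-- Over `ℂ`: a sum of complex numbers of norm `1` equals their number only if all are `1`. -/
lemma eq_one_of_sum_eq_card {s : Multiset ℂ} (hs : ∀ z ∈ s, ‖z‖ = 1) (h : s.sum = s.card) :
    ∀ z ∈ s, z = 1 := by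
  have hre : ∀ z ∈ s, z.re ≤ 1 := fun z hz => (Complex.re_le_norm z).trans (hs z hz).le
  have h1 : (s.map Complex.re).sum = (s.map fun _ => (1 : ℝ)).sum := by
    have := congrArg Complex.reAddGroupHom h
    rw [map_multiset_sum] at this
    simpa using this
  intro z hz
  have h2 : z.re = 1 := by
    by_contra hne
    exact (Multiset.sum_lt_sum hre ⟨z, hz, lt_of_le_of_ne (hre z hz) hne⟩).ne h1
  have h3 := hs z hz
  rw [← sq_eq_sq₀ (norm_nonneg z) zero_le_one, Complex.sq_norm, Complex.normSq_apply, h2] at h3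
  refine Complex.ext h2 ?_
  simpa using h3

/-- A sum of `N`-th roots of unity in characteristic zero equals their number only if all
are `1`. -/
lemma eq_one_of_sum_rootsOfUnity_eq_card {k : Type*} [Field k] [CharZero k] {N : ℕ} (hN : N ≠ 0)
    {s : Multiset k} (hs : ∀ z ∈ s, z ^ N = 1) (h : s.sum = s.card) : ∀ z ∈ s, z = 1 := by
  -- `k` itself may be too large to embed in `ℂ`, but the subfield generated by the `N`-th roots of
  -- unity is algebraic over `ℚ`.
  let K := IntermediateField.adjoin ℚ {z : k | z ^ N = 1}
  have hK : Algebra.IsAlgebraic ℚ K := by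
    apply IntermediateField.isAlgebraic_adjoin
    intro z hz
    exact IsIntegral.of_pow (Nat.pos_of_ne_zero hN)
      (by rw [show z ^ N = 1 from hz]; exact isIntegral_one)
  let f : K →ₐ[ℚ] ℂ := IsAlgClosed.lift
  let t : Multiset K := s.pmap (fun z hz => ⟨z, hz⟩)
    fun z hz => IntermediateField.subset_adjoin ℚ _ (hs z hz)
  have ht : t.map (algebraMap K k) = s := by
    rw [Multiset.map_pmap]
    simp [Multiset.pmap_eq_map]
  have hpow : ∀ x ∈ t, x ^ N = 1 := fun x hx => by
    apply (algebraMap K k).injective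
    rw [map_pow, map_one]
    exact hs _ (ht ▸ Multiset.mem_map_of_mem _ hx)
  have hsum : t.sum = t.card := by
    apply (algebraMap K k).injective
    rw [map_multiset_sum, ht, h, map_natCast, Multiset.card_pmap]
  have hC := eq_one_of_sum_eq_card (s := t.map f) (by
      intro z hz
      obtain ⟨x, hx, rfl⟩ := Multiset.mem_map.1 hz
      exact Complex.norm_eq_one_of_pow_eq_one (n := N) (by rw [← map_pow, hpow x hx, map_one]) hN)
    (by rw [← map_multiset_sum, hsum, map_natCast, Multiset.card_map])
  intro z hz
  rw [← ht] at hz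
  obtain ⟨x, hx, rfl⟩ := Multiset.mem_map.1 hz
  have : f x = f 1 := by rw [map_one]; exact hC _ (Multiset.mem_map_of_mem _ hx)
  rw [f.injective this, map_one]

open Polynomial in
/-- An endomorphism of finite order whose trace is the dimension is the identity. -/
lemma eq_one_of_trace_eq_finrank {k V : Type*} [Field k] [IsAlgClosed k] [CharZero k]
    [AddCommGroup V] [Module k V] [FiniteDimensional k V] {T : End k V} {N : ℕ} (hN : N ≠ 0)
    (hT : T ^ N = 1) (h : LinearMap.trace k V T = finrank k V) : T = 1 := by
  have hsplit := IsAlgClosed.splits T.charpoly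
  have hroots : ∀ z ∈ T.charpoly.roots, z ^ N = 1 := by
    intro z hz
    have hz' := (End.hasEigenvalue_iff_isRoot_charpoly T z).2 (isRoot_of_mem_roots hz)
    obtain ⟨v, hv⟩ := hz'.exists_hasEigenvector
    have h1 := hv.pow_apply N
    rw [hT, End.one_apply] at h1
    have h2 : (z ^ N - 1) • v = 0 := by rw [sub_smul, ← h1, one_smul, sub_self]
    exact sub_eq_zero.1 ((smul_eq_zero.1 h2).resolve_right hv.2)
  have hcard : T.charpoly.roots.card = finrank k V := by
    rw [← hsplit.natDegree_eq_card_roots, LinearMap.charpoly_natDegree]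
  have hone := eq_one_of_sum_rootsOfUnity_eq_card hN hroots (by
    rw [← End.trace_eq_sum_roots_charpoly_of_splits hsplit, h, hcard])
  have hchar : T.charpoly = (X - C 1) ^ finrank k V := by
    rw [hsplit.eq_prod_roots_of_monic T.charpoly_monic,
      Multiset.eq_replicate.2 ⟨hcard, hone⟩]
    simp
  -- The minimal polynomial divides a power of `X - 1`, and it is squarefree because it divides the
  -- separable polynomial `X ^ N - 1`.
  have hdvd : minpoly k T ∣ X - C 1 := by
    have hsq : Squarefree (minpoly k T) := by
      refine Squarefree.squarefree_of_dvd (minpoly.dvd k T (p := X ^ N - 1) (by simp [hT])) ?_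
      exact (separable_X_pow_sub_C (1 : k) (by exact_mod_cast hN) one_ne_zero).squarefree
    exact hsq.isRadical _ _ (hchar ▸ LinearMap.minpoly_dvd_charpoly T)
  have := aeval_eq_zero_of_dvd_aeval_eq_zero hdvd (minpoly.aeval k T)
  simpa [sub_eq_zero] using this

end RootsOfUnity

/-! ### The Galois map, the trace identity and divisibility. -/

section Hopf

variable {k : Type*} [Field k] {H : Type*} [Ring H] [HopfAlgebra k H]

open LinearMap TensorProduct

variable (k H) in
/-- The Galois map `h ⊗ x ↦ h x₁ ⊗ x₂`. -/
def galoisMap : H ⊗[k] H →ₗ[k] H ⊗[k] H :=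
  (LinearMap.mul' k H).rTensor H ∘ₗ (TensorProduct.assoc k H H H).symm.toLinearMap ∘ₗ
    Coalgebra.comul.lTensor H

lemma galoisMap_tmul (h x : H) :
    galoisMap k H (h ⊗ₜ x) = (LinearMap.mulLeft k h).rTensor H (Coalgebra.comul x) := by
  have : (LinearMap.mul' k H).rTensor H ∘ₗ (TensorProduct.assoc k H H H).symm.toLinearMap ∘ₗ
      TensorProduct.mk k H (H ⊗[k] H) h = (LinearMap.mulLeft k h).rTensor H := by
    ext a b; simp
  exact LinearMap.congr_fun this (Coalgebra.comul x)

/-- The antipode provides the left inverse `h ⊗ x ↦ h S(x₁) ⊗ x₂`. -/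
lemma galoisMap_injective : Function.Injective (galoisMap k H) := by
  let Ψ : H ⊗[k] H →ₗ[k] H ⊗[k] H :=
    (LinearMap.mul' k H).rTensor H ∘ₗ (TensorProduct.assoc k H H H).symm.toLinearMap ∘ₗ
      ((HopfAlgebra.antipode k).rTensor H ∘ₗ Coalgebra.comul).lTensor H
  have key : Ψ ∘ₗ galoisMap k H = LinearMap.id := by
    ext h x
    have h1 : ∀ y : H ⊗[k] H, Ψ ((LinearMap.mulLeft k h).rTensor H y) =
        (LinearMap.mulLeft k h).rTensor H (((LinearMap.mul' k H) ∘ₗ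
          (HopfAlgebra.antipode k).lTensor H).rTensor H
          ((TensorProduct.assoc k H H H).symm (Coalgebra.comul.lTensor H y))) := by
      intro y
      induction y with
      | zero => simp
      | add y z hy hz => simp only [map_add, hy, hz]
      | tmul a b =>
        simp only [Ψ, LinearMap.comp_apply, rTensor_tmul, lTensor_tmul]
        generalize (Coalgebra.comul b : H ⊗[k] H) = z
        induction z with
        | zero => simp
        | add y z hy hz => simp only [map_add, tmul_add, hy, hz]
        | tmul c d => simp [mul_assoc]
    have h2 : (((LinearMap.mul' k H) ∘ₗ (HopfAlgebra.antipode k).lTensor H).rTensor H)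
        (Coalgebra.comul.rTensor H (Coalgebra.comul x)) = (1 : H) ⊗ₜ[k] x := by
      rw [← LinearMap.comp_apply, ← LinearMap.rTensor_comp, LinearMap.comp_assoc,
        HopfAlgebra.mul_antipode_lTensor_comul, LinearMap.rTensor_comp, LinearMap.comp_apply,
        Coalgebra.rTensor_counit_comul]
      simp
    simp only [AlgebraTensorModule.curry_apply, TensorProduct.curry_apply,
      LinearMap.coe_restrictScalars, LinearMap.comp_apply, LinearMap.id_apply]
    rw [galoisMap_tmul, h1, Coalgebra.coassoc_symm_apply, h2]
    simp
  exact Function.LeftInverse.injective (g := Ψ) (LinearMap.congr_fun key)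

/-- Right multiplication by a group-like element. -/
def rightMul (g : GroupLike k H) : H ≃ₗc[k] H where
  toFun x := x * g.val
  map_add' x y := add_mul x y _
  map_smul' c x := smul_mul_assoc c x _
  invFun x := x * (g⁻¹).val
  left_inv x := by
    change x * g.val * (g⁻¹).val = x
    rw [mul_assoc, ← GroupLike.val_mul, mul_inv_cancel, GroupLike.val_one, mul_one]
  right_inv x := by
    change x * (g⁻¹).val * g.val = x
    rw [mul_assoc, ← GroupLike.val_mul, inv_mul_cancel, GroupLike.val_one, mul_one]
  counit_comp := by
    ext x
    simp [Bialgebra.counit_mul]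
  map_comp_comul := by
    ext x
    simp only [LinearMap.comp_apply, LinearMap.coe_mk, AddHom.coe_mk, Bialgebra.comul_mul,
      g.isGroupLikeElem_val.comul_eq_tmul_self]
    generalize (Coalgebra.comul x : H ⊗[k] H) = z
    induction z with
    | zero => simp
    | add y z hy hz => simp only [map_add, add_mul, hy, hz]
    | tmul c d => simp

@[simp]
lemma rightMul_apply (g : GroupLike k H) (x : H) : rightMul g x = x * g.val := rfl

lemma galoisMap_lTensor_rightMul (g : GroupLike k H) (y : H ⊗[k] H) :
    galoisMap k H ((rightMul g : H →ₗ[k] H).lTensor H y) =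
      TensorProduct.map (rightMul g : H →ₗ[k] H) (rightMul g : H →ₗ[k] H) (galoisMap k H y) := by
  induction y with
  | zero => simp
  | add y z hy hz => simp only [map_add, hy, hz]
  | tmul h x =>
    rw [LinearMap.lTensor_tmul, galoisMap_tmul, galoisMap_tmul]
    erw [comul_coalgEquiv]
    generalize (Coalgebra.comul x : H ⊗[k] H) = z
    induction z with
    | zero => simp
    | add y z hy hz => simp only [map_add, hy, hz]
    | tmul c d => simp [mul_assoc]

variable [FiniteDimensional k H]

/-- The Galois map preserves `H ⊗ X` because `X` is a left coideal, and it conjugates `id ⊗ R_g` to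
`R_g ⊗ R_g`. Comparing traces gives the identity. -/
lemma finrank_mul_trace_restrict {X : Submodule k H} (hX : IsLeftCoideal X) (g : GroupLike k H)
    (hg : X ≤ X.comap (rightMul g : H →ₗ[k] H)) :
    (finrank k H : k) * trace k X ((rightMul g : H →ₗ[k] H).restrict hg) =
      trace k H (rightMul g : H →ₗ[k] H) *
        trace k X ((rightMul g : H →ₗ[k] H).restrict hg) := by
  set R := (rightMul g : H →ₗ[k] H)
  set RX := R.restrict hg
  have hι : Function.Injective (X.subtype.lTensor H) :=
    Module.Flat.lTensor_preserves_injective_linearMap _ X.injective_subtype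
  have hrange : ∀ y, galoisMap k H (X.subtype.lTensor H y) ∈ range (X.subtype.lTensor H) := by
    intro y
    induction y with
    | zero => simp
    | add y z hy hz => simp only [map_add]; exact add_mem hy hz
    | tmul h x =>
      rw [lTensor_tmul, galoisMap_tmul]
      have : tensorSub k ⊤ X ≤
          (range (X.subtype.lTensor H)).comap ((LinearMap.mulLeft k h).rTensor H) :=
        tensorSub_le_iff.2 fun a _ b hb => ⟨(h * a) ⊗ₜ ⟨b, hb⟩, by simp⟩
      exact this (hX x.2)
  let Φ₀ : H ⊗[k] X →ₗ[k] H ⊗[k] X :=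
    (LinearEquiv.ofInjective _ hι).symm.toLinearMap ∘ₗ
      (galoisMap k H ∘ₗ X.subtype.lTensor H).codRestrict _ hrange
  have hΦ₀ : ∀ y, X.subtype.lTensor H (Φ₀ y) = galoisMap k H (X.subtype.lTensor H y) := fun y =>
    congrArg Subtype.val ((LinearEquiv.ofInjective _ hι).apply_symm_apply
      ⟨galoisMap k H (X.subtype.lTensor H y), hrange y⟩)
  have hinj : Function.Injective Φ₀ := by
    intro y z hyz
    apply hι
    apply galoisMap_injective
    rw [← hΦ₀, ← hΦ₀, hyz]
  -- Finite dimension makes the injective endomorphism invertible, so no inverse preserving `H ⊗ X`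
  -- has to be exhibited.
  let Φ := LinearEquiv.ofInjectiveEndo Φ₀ hinj
  have hcomm : Φ₀ ∘ₗ TensorProduct.map LinearMap.id RX = TensorProduct.map R RX ∘ₗ Φ₀ := by
    ext1
    ext1 h
    ext1 x
    apply hι
    have h1 : ∀ y, X.subtype.lTensor H (TensorProduct.map R RX y) =
        TensorProduct.map R R (X.subtype.lTensor H y) := by
      intro y
      induction y with
      | zero => simp
      | add y z hy hz => simp only [map_add, hy, hz]
      | tmul a b => rfl
    change X.subtype.lTensor H (Φ₀ (h ⊗ₜ RX x)) =
      X.subtype.lTensor H (TensorProduct.map R RX (Φ₀ (h ⊗ₜ x)))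
    rw [h1, hΦ₀, hΦ₀, ← galoisMap_lTensor_rightMul]
    rfl
  have hconj : Φ.conj (TensorProduct.map LinearMap.id RX) = TensorProduct.map R RX := by
    ext1
    ext1 h
    ext1 x
    have := LinearMap.congr_fun hcomm (Φ.symm (h ⊗ₜ x))
    have h2 : Φ₀ (Φ.symm (h ⊗ₜ x)) = h ⊗ₜ x := Φ.apply_symm_apply _
    simp only [LinearMap.comp_apply, h2] at this
    exact this
  have := LinearMap.trace_conj' (TensorProduct.map LinearMap.id RX) Φ
  rw [hconj, LinearMap.trace_tensorProduct', LinearMap.trace_tensorProduct', LinearMap.trace_id]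
    at this
  exact this.symm

instance finite_groupLike : Finite (GroupLike k H) :=
  (linearIndep_groupLikeVal (R := k) (A := H)).finite

/-- The representation of the group of group-like elements on a subspace that is stable under
right multiplication by them. -/
def rightMulRep (X : Submodule k H)
    (hg : ∀ g : GroupLike k H, X ≤ X.comap (rightMul g : H →ₗ[k] H)) :
    Representation k (GroupLike k H) X where
  -- The inverse turns the right action into a left one.
  toFun g := (rightMul g⁻¹ : H →ₗ[k] H).restrict (hg g⁻¹)
  map_one' := by ext x; simp [LinearMap.restrict_apply]
  map_mul' g h := by
    ext x
    simp [LinearMap.restrict_apply, mul_assoc, -GroupLike.val_inv, ← GroupLike.val_mul]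

variable [IsAlgClosed k] [CharZero k]

/-- Cancelling a nonzero trace on `X` leaves tr_H(`R_g`) = dim `H`. Then `R_g` is the identity, and
evaluating it at `1` gives `g = 1`. -/
lemma trace_restrict_rightMul_eq_zero {X : Submodule k H} (hX : IsLeftCoideal X)
    {g : GroupLike k H} (hg1 : g ≠ 1) (hg : X ≤ X.comap (rightMul g : H →ₗ[k] H)) :
    trace k X ((rightMul g : H →ₗ[k] H).restrict hg) = 0 := by
  by_contra hne
  have h1 := mul_right_cancel₀ hne (finrank_mul_trace_restrict hX g hg)
  have hpow : ∀ n : ℕ, (rightMul g : H →ₗ[k] H) ^ n = (rightMul (g ^ n) : H →ₗ[k] H) := by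
    intro n
    induction n with
    | zero => ext x; simp
    | succ n ih => ext x; rw [pow_succ', Module.End.mul_apply, ih]; simp [mul_assoc, pow_succ]
  have h2 := eq_one_of_trace_eq_finrank (T := (rightMul g : H →ₗ[k] H)) (N := orderOf g)
    (orderOf_pos g).ne' (by rw [hpow, pow_orderOf_eq_one]; ext x; simp) h1.symm
  apply hg1
  ext
  simpa using LinearMap.congr_fun h2 1

/-- The dimension of a left coideal stable under right multiplication by group-like elements is
divisible by the number of group-like elements. -/
lemma card_groupLike_dvd_finrank {X : Submodule k H} (hX : IsLeftCoideal X)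
    (hg : ∀ g : GroupLike k H, X ≤ X.comap (rightMul g : H →ₗ[k] H)) :
    Nat.card (GroupLike k H) ∣ finrank k X := by
  have := Fintype.ofFinite (GroupLike k H)
  have hne : (Nat.card (GroupLike k H) : k) ≠ 0 := by exact_mod_cast Nat.card_pos.ne'
  have := invertibleOfNonzero hne
  -- The average of the character is the dimension of the invariants; only `g = 1` contributes, so
  -- dim `X` is |G(H)| times that dimension.
  have h := (rightMulRep X hg).card_inv_mul_sum_char_eq_finrank
  have hchar : ∀ g : GroupLike k H, g ≠ 1 → (rightMulRep X hg).character g = 0 := fun g hg1 =>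
    trace_restrict_rightMul_eq_zero hX (inv_ne_one.2 hg1) (hg g⁻¹)
  rw [Finset.sum_eq_single 1 (fun g _ hg1 => hchar g hg1) (by simp),
    Representation.char_one, inv_mul_eq_iff_eq_mul₀ hne] at h
  exact ⟨_, by exact_mod_cast h⟩

end Hopf
end HopfBlocks

end

theorem corollary2 {k : Type*} [Field k] [IsAlgClosed k] [CharZero k]
    {H : Type*} [Ring H] [HopfAlgebra k H] [FiniteDimensional k H]
    (hH : ¬ HopfBlocks.IsCosemisimple k H)
    (S : HopfBlocks.BlockSystem k H) :
    Module.finrank k (S.block 0 1 1) = Nat.card (GroupLike k H) ∧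
    ∀ n d₁ d₂ : ℕ, 1 ≤ d₁ → 1 ≤ d₂ →
      Module.finrank k (S.block 0 1 1) ∣ Module.finrank k (S.block n d₁ d₂) := by
  have hfilt : ∀ n, Nat.card (GroupLike k H) ∣
      Module.finrank k (HopfBlocks.coradicalFiltration k H n) := fun n =>
    HopfBlocks.card_groupLike_dvd_finrank (HopfBlocks.isLeftCoideal_coradicalFiltration k H n)
      fun g => HopfBlocks.coradicalFiltration_le_comap (HopfBlocks.rightMul g) n
  refine ⟨S.finrank_block_zero_one_one, fun n d₁ d₂ _ _ => ?_⟩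
  rw [S.finrank_block_zero_one_one]
  cases n with
  | zero =>
    exact HopfBlocks.card_groupLike_dvd_finrank (S.isLeftCoideal_block_zero d₁ d₂)
      fun g => S.block_zero_le_comap d₁ d₂ (HopfBlocks.rightMul g)
  | succ n =>
    -- The filtration term has dimension divisible by |G(H)|, so it suffices to treat its direct sum
    -- with the block.
    rw [← Nat.dvd_add_right (hfilt n), ← S.finrank_filtration_sup_block]
    exact HopfBlocks.card_groupLike_dvd_finrank (S.isLeftCoideal_filtration_sup_block n d₁ d₂)
      fun g => S.filtration_sup_block_le_comap n d₁ d₂ (HopfBlocks.rightMul g)
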